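/- Let $\mathbb F_q$ be a finite field, let $F_1\subsetneq\cdots\subsetneq F_\lambda\subseteq\mathbb F_q$ be subfields, and let $\mu_1,\dots,\mu_\lambda$ be positive integers. Put $s_0=0$, $s_t=\mu_1+\cdots+\mu_t$ for $1\le t\le\lambda$, and $m=s_\lambda\ge 1$. For $1\le k\le m$ let $t_k$ be the unique integer with $s_{t_k-1}<k\le s_{t_k}$, and put $A_k=F_{t_k}$, $d_k=|A_k|$ and $\mathcal A=A_1\times\cdots\times A_m=F_1^{\mu_1}\times\cdots\times F_\lambda^{\mu_\lambda}\subseteq\mathbb F_q^m$. For an integer $u\ge 0$ let $\mathrm{AC}_q(u,\mathcal A)\subseteq\mathbb F_q^{\mathcal A}$ be the affine Cartesian code of order $u$, i.e. the set of all words $(f(P))_{P\in\mathcal A}$, where $f\in\mathbb F_q[X_1,\dots,X_m]$ satisfies $\deg f\le u$ and $\deg_{X_i}f<d_i$ for $1\le i\le m$. A minimum weight codeword is a nonzero codeword whose Hamming weight is least among all nonzero codewords. Let $0\le j<m$, $u=\sum_{i=1}^{j+1}(d_i-1)$ and $r=t_{j+1}$. Then the number of minimum weight codewords of $\mathrm{AC}_q(u,\mathcal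 A)$ is $$(q-1)\Big(\prod_{i=1}^{j+1}d_i\Big)\genfrac{[}{]}{0pt}{}{\mu_r}{j+1-s_{r-1}}_{d_{j+1}},$$ where $\genfrac{[}{]}{0pt}{}{n}{k}_{d}$ denotes the Gaussian binomial coefficient, i.e. the number of $k$-dimensional linear subspaces of $\mathbb F_d^{\,n}$. -/

import Mathlib

/-- `partialSum μ t` is `s_t = μ_1 + ⋯ + μ_t` (the sum of the first `t` block lengths),
so that `partialSum μ 0 = 0`. -/
def partialSum {lam : ℕ} (μ : Fin lam → ℕ) (t : ℕ) : ℕ :=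
  ∑ i : Fin lam with i.val < t, μ i

/-- The coordinate `k` (counted from `0`) lies in the block `t` (counted from `0`).
With both counted from `1` this reads `s_{t-1} < k ≤ s_t`, that is, `t = t_k`. -/
def InBlock {lam m : ℕ} (μ : Fin lam → ℕ) (t : Fin lam) (k : Fin m) : Prop :=
  partialSum μ t.val ≤ k.val ∧ k.val < partialSum μ (t.val + 1)

/-- The space of polynomials of total degree at most `u` whose degree in the `i`-th variable
is less than `d_i = |A_i|` for every `i`. -/
def reducedPolys {F : Type*} [Field F] [Finite F] {m : ℕ} (A : Fin m → Subfield F) (u : ℕ) :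
    Submodule F (MvPolynomial (Fin m) F) where
  carrier := {f | f.totalDegree ≤ u ∧ ∀ i, f.degreeOf i < Nat.card (A i)}
  zero_mem' := ⟨by simp, fun i => by simp⟩
  add_mem' {f g} hf hg :=
    ⟨(MvPolynomial.totalDegree_add f g).trans (max_le hf.1 hg.1),
      fun i => (MvPolynomial.degreeOf_add_le i f g).trans_lt (max_lt (hf.2 i) (hg.2 i))⟩
  smul_mem' a f hf :=
    ⟨(MvPolynomial.totalDegree_smul_le a f).trans hf.1, fun i => by
      rw [MvPolynomial.smul_eq_C_mul]
      exact (MvPolynomial.degreeOf_C_mul_le f i a).trans_lt (hf.2 i)⟩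

/-- Evaluation of polynomials at all the points of `A_1 × ⋯ × A_m`; words are indexed by the
points of this product. -/
noncomputable def evalWord {F : Type*} [Field F] {m : ℕ} (A : Fin m → Subfield F) :
    MvPolynomial (Fin m) F →ₗ[F] (((i : Fin m) → A i) → F) where
  toFun f := fun P => MvPolynomial.eval (fun i => (P i : F)) f
  map_add' f g := by ext P; simp
  map_smul' a f := by ext P; simp [MvPolynomial.smul_eval]

/-- The affine Cartesian code of order `u` on `A_1 × ⋯ × A_m`. -/
noncomputable def affineCartesianCode {F : Type*} [Field F] [Finite F] {m : ℕ} (A : Fin m → Subfield F)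
    (u : ℕ) : Submodule F (((i : Fin m) → A i) → F) :=
  (reducedPolys A u).map (evalWord A)

open Classical in
/-- The Hamming weight of a word indexed by a finite type. -/
noncomputable def wordWeight {ι F : Type*} [Finite ι] [Zero F] (c : ι → F) : ℕ :=
  letI := Fintype.ofFinite ι
  hammingNorm c

/-- The minimum weight codewords of a linear code: the nonzero codewords whose weight is least
among the nonzero codewords. -/
def minWeightWords {ι F : Type*} [Finite ι] [Field F] (C : Submodule F (ι → F)) :
    Set (ι → F) :=
  {c | c ∈ C ∧ c ≠ 0 ∧ ∀ c' ∈ C, c' ≠ 0 → wordWeight c ≤ wordWeight c'}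

/-- The Gaussian binomial coefficient `[n choose k]_{|K|}` for a finite field `K`: the number of
`k`-dimensional linear subspaces of `K^n`. -/
noncomputable def gaussianBinomial (K : Type*) [Field K] (n k : ℕ) : ℕ :=
  Nat.card {W : Submodule K (Fin n → K) // Module.finrank K W = k}

/-!
A word of the code of order `u` is orthogonal to all monomials of degree less than
`∑ (d_i - 1) - u`, because the values of a reduced monomial sum to zero unless it is the top one.
Hence the vanishing ideal of the support `S` of a nonzero word has a standard monomial `b` of degree
at least `∑ (d_i - 1) - u`. All divisors of `b` are standard as well, so `|S| ≥ ∏ (b_i + 1)`, and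
log-concavity bounds this product below by `∏_{i > j+1} d_i`.

If `S` attains the bound, then each `b_i` is `0` or `d_i - 1`, and the divisors of `b` are all the
standard monomials. For a degree-compatible order every coordinate is therefore affine on `S` in the
coordinates with `b_i ≠ 0`. A coordinate cannot depend on another one that takes more values, so `S`
consists of a fixed point in the coordinates over fields smaller than `K = A_{j+1}`, a coset of a
`K`-subspace in the coordinates over `K`, and everything in the remaining ones. Conversely the
indicator of such a set is a codeword, and by orthogonality to `b` a word supported in `S` is
determined up to a scalar, so it remains to count these sets.
-/

/-! ### Boxes of exponents with a large sum -/

section Boxes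

/-- The height of the graph of `x ↦ log (x + 1)` above its chord over `[0, e]`. Since it differs
from `log (x + 1)` by a linear term, bounds on `∏ (aᵢ + 1)` at fixed `∑ aᵢ` can be checked one
factor at a time. -/
noncomputable def logChordGap (e x : ℝ) : ℝ :=
  Real.log (x + 1) - Real.log (e + 1) / e * x

@[simp]
lemma logChordGap_zero (e : ℝ) : logChordGap e 0 = 0 := by simp [logChordGap]

lemma logChordGap_self {e : ℝ} (he : e ≠ 0) : logChordGap e e = 0 := by
  simp [logChordGap, he]

lemma strictConcaveOn_logChordGap (e : ℝ) : StrictConcaveOn ℝ (Set.Ici 0) (logChordGap e) := by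
  have hlog : StrictConcaveOn ℝ (Set.Ici 0) fun x : ℝ => Real.log (x + 1) :=
    (strictConcaveOn_log_Ioi.translate_left 1).subset
      (fun x (hx : 0 ≤ x) => Set.mem_preimage.mpr (by rw [Set.mem_Ioi]; linarith)) (convex_Ici 0)
  exact hlog.sub_convexOn ((LinearMap.mulLeft ℝ (Real.log (e + 1) / e)).convexOn (convex_Ici 0))

lemma min_logChordGap_lt (e : ℝ) {x y : ℝ} (hx : 0 < x) (hxy : x < y) :
    min 0 (logChordGap e y) < logChordGap e x := by
  have hmem : x ∈ openSegment ℝ 0 y := by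
    rw [openSegment_eq_Ioo (hx.trans hxy)]
    exact ⟨hx, hxy⟩
  simpa using (strictConcaveOn_logChordGap e).lt_on_openSegment Set.self_mem_Ici
    (hx.trans hxy).le (hx.trans hxy).ne hmem

lemma logChordGap_pos {e x : ℝ} (hx : 0 < x) (hxe : x < e) : 0 < logChordGap e x := by
  simpa [logChordGap_self (hx.trans hxe).ne'] using min_logChordGap_lt e hx hxe

lemma logChordGap_neg {e x : ℝ} (he : 0 < e) (hex : e < x) : logChordGap e x < 0 := by
  simpa [logChordGap_self he.ne'] using min_logChordGap_lt e he hex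

lemma logChordGap_nonpos {e x : ℝ} (he : 0 < e) (hex : e ≤ x) : logChordGap e x ≤ 0 := by
  rcases hex.eq_or_lt with rfl | hex
  exacts [(logChordGap_self he.ne').le, (logChordGap_neg he hex).le]

lemma logChordGap_lt_logChordGap {e x y : ℝ} (he : 0 < e) (hx : 0 < x) (hxy : x < y)
    (hey : e ≤ y) : logChordGap e y < logChordGap e x := by
  simpa [logChordGap_nonpos he hey] using min_logChordGap_lt e hx hxy

lemma logChordGap_nonneg {e x : ℝ} (hx : 0 ≤ x) (hxe : x ≤ e) : 0 ≤ logChordGap e x := by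
  rcases hx.eq_or_lt with rfl | hx
  · exact (logChordGap_zero e).ge
  · rcases hxe.eq_or_lt with rfl | hxe
    exacts [(logChordGap_self hx.ne').ge, (logChordGap_pos hx hxe).le]

lemma logChordGap_le_logChordGap {e x y : ℝ} (he : 0 < e) (hx : 0 ≤ x) (hxy : x ≤ y)
    (hey : e ≤ y) : logChordGap e y ≤ logChordGap e x := by
  rcases hx.eq_or_lt with rfl | hx
  · exact (logChordGap_nonpos he hey).trans_eq (logChordGap_zero e).symm
  · rcases hxy.eq_or_lt with rfl | hxy
    exacts [le_rfl, (logChordGap_lt_logChordGap he hx hxy hey).le]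

variable {ι : Type*} {D a b : ι → ℕ} {e : ℕ} {H : Finset ι}

open Classical in
lemma logChordGap_ite_le (he : 0 < e) (hH : ∀ i ∈ H, e ≤ D i) (hH' : ∀ i ∉ H, D i ≤ e)
    (haD : ∀ i, a i ≤ D i) (i : ι) :
    logChordGap e (if i ∈ H then D i else 0 : ℕ) ≤ logChordGap e (a i) := by
  split_ifs with hi
  · exact logChordGap_le_logChordGap (mod_cast he) (Nat.cast_nonneg _) (mod_cast haD i)
      (mod_cast hH i hi)
  · simpa using logChordGap_nonneg (Nat.cast_nonneg _) (mod_cast (haD i).trans (hH' i hi))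

lemma prod_sub_one_add_one {d : ι → ℕ} (hb : ∀ i, b i < d i) (s : Finset ι) :
    ∏ i ∈ s, (d i - 1 + 1) = ∏ i ∈ s, d i :=
  Finset.prod_congr rfl fun i _ => Nat.sub_add_cancel (Nat.one_le_of_lt (hb i))

variable [Fintype ι]

lemma log_prod_add_one (e : ℝ) (a : ι → ℕ) :
    Real.log (∏ i, (a i + 1) : ℕ) =
      ∑ i, logChordGap e (a i) + Real.log (e + 1) / e * (∑ i, a i : ℕ) := by
  push_cast
  rw [Real.log_prod fun i _ => by positivity, Finset.mul_sum, ← Finset.sum_add_distrib]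
  simp [logChordGap]

lemma slope_mul_sum_le (e : ℕ) (hsum : ∑ i, b i ≤ ∑ i, a i) :
    Real.log (e + 1) / e * (∑ i, b i : ℕ) ≤ Real.log (e + 1) / e * (∑ i, a i : ℕ) := by
  have hslope : 0 ≤ Real.log (e + 1) / e :=
    div_nonneg (Real.log_nonneg (by simp)) (Nat.cast_nonneg _)
  gcongr

lemma prod_add_one_le_of_logChordGap_le (hb : ∀ i, logChordGap e (b i) ≤ logChordGap e (a i))
    (hsum : ∑ i, b i ≤ ∑ i, a i) : ∏ i, (b i + 1) ≤ ∏ i, (a i + 1) := by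
  have hlog : Real.log (∏ i, (b i + 1) : ℕ) ≤ Real.log (∏ i, (a i + 1) : ℕ) := by
    rw [log_prod_add_one e, log_prod_add_one e]
    exact add_le_add (Finset.sum_le_sum fun i _ => hb i) (slope_mul_sum_le e hsum)
  exact_mod_cast (Real.log_le_log_iff (by positivity) (by positivity)).mp hlog

lemma logChordGap_eq_of_prod_add_one_le
    (hb : ∀ i, logChordGap e (b i) ≤ logChordGap e (a i)) (hsum : ∑ i, b i ≤ ∑ i, a i)
    (hprod : ∏ i, (a i + 1) ≤ ∏ i, (b i + 1)) (i : ι) :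
    logChordGap e (b i) = logChordGap e (a i) := by
  refine (Finset.sum_eq_sum_iff_of_le fun i _ => hb i).mp (le_antisymm ?_ ?_) i (Finset.mem_univ i)
  · exact Finset.sum_le_sum fun i _ => hb i
  · have hlog : Real.log (∏ i, (a i + 1) : ℕ) ≤ Real.log (∏ i, (b i + 1) : ℕ) :=
      Real.log_le_log (by positivity) (by exact_mod_cast hprod)
    have hslope := slope_mul_sum_le e hsum
    rw [log_prod_add_one e, log_prod_add_one e] at hlog
    linarith

theorem prod_add_one_le_of_sum_le (he : 0 < e) (hH : ∀ i ∈ H, e ≤ D i)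
    (hH' : ∀ i ∉ H, D i ≤ e) (haD : ∀ i, a i ≤ D i) (hsum : ∑ i ∈ H, D i ≤ ∑ i, a i) :
    ∏ i ∈ H, (D i + 1) ≤ ∏ i, (a i + 1) := by
  classical
  have h := prod_add_one_le_of_logChordGap_le (logChordGap_ite_le he hH hH' haD)
    (by simpa using hsum)
  simpa [Finset.prod_ite_mem, apply_ite (· + 1)] using h

theorem eq_zero_or_eq_of_prod_add_one_le (he : 0 < e) (hH : ∀ i ∈ H, e ≤ D i)
    (hH' : ∀ i ∉ H, D i ≤ e) (haD : ∀ i, a i ≤ D i) (hsum : ∑ i ∈ H, D i ≤ ∑ i, a i)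
    (hprod : ∏ i, (a i + 1) ≤ ∏ i ∈ H, (D i + 1)) (i : ι) :
    (a i = 0 ∧ D i ≤ e) ∨ (a i = D i ∧ e ≤ D i) := by
  classical
  have heq := logChordGap_eq_of_prod_add_one_le (logChordGap_ite_le he hH hH' haD)
    (by simpa using hsum) (by simpa [Finset.prod_ite_mem, apply_ite (· + 1)] using hprod) i
  have he' : (0 : ℝ) < e := mod_cast he
  rcases Nat.eq_zero_or_pos (a i) with ha | ha
  · refine Or.inl ⟨ha, ?_⟩
    by_contra! hlt
    have hneg := logChordGap_neg he' (mod_cast hlt : (e : ℝ) < D i)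
    have hi : i ∈ H := by_contra fun hi => (hH' i hi).not_gt hlt
    rw [if_pos hi, ha, Nat.cast_zero, logChordGap_zero] at heq
    exact hneg.ne heq
  · refine Or.inr ?_
    have ha' : (0 : ℝ) < a i := mod_cast ha
    by_cases hi : i ∈ H
    · refine ⟨(haD i).eq_of_not_lt fun hlt => ?_, hH i hi⟩
      rw [if_pos hi] at heq
      exact (logChordGap_lt_logChordGap he' ha' (mod_cast hlt) (mod_cast hH i hi)).ne heq
    · have hae : e ≤ a i := by
        by_contra! hlt
        rw [if_neg hi, Nat.cast_zero, logChordGap_zero] at heq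
        exact (logChordGap_pos ha' (mod_cast hlt)).ne heq
      exact ⟨(haD i).antisymm ((hH' i hi).trans hae), hae.trans (haD i)⟩

variable [DecidableEq ι] {d : ι → ℕ} {q : ℕ} {L : Finset ι}

lemma sum_compl_le_of_sum_le (h : ∑ i, d i ≤ ∑ i ∈ L, d i + ∑ i, b i) :
    ∑ i ∈ Lᶜ, d i ≤ ∑ i, b i := by
  rwa [← Finset.sum_add_sum_compl L, add_le_add_iff_left] at h

theorem prod_compl_le_prod_add_one (hq : 1 < q) (hL : ∀ i ∈ L, d i ≤ q) (hL' : ∀ i ∉ L, q ≤ d i)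
    (hb : ∀ i, b i < d i) (hsum : ∑ i, (d i - 1) ≤ ∑ i ∈ L, (d i - 1) + ∑ i, b i) :
    ∏ i ∈ Lᶜ, d i ≤ ∏ i, (b i + 1) := by
  rw [← prod_sub_one_add_one hb]
  exact prod_add_one_le_of_sum_le (Nat.sub_pos_of_lt hq)
    (fun i hi => Nat.sub_le_sub_right (hL' i (Finset.mem_compl.mp hi)) 1)
    (fun i hi => Nat.sub_le_sub_right (hL i (Finset.notMem_compl.mp hi)) 1)
    (fun i => Nat.le_sub_one_of_lt (hb i)) (sum_compl_le_of_sum_le hsum)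

theorem eq_zero_or_add_one_eq_of_prod_le (hq : 1 < q) (hL : ∀ i ∈ L, d i ≤ q)
    (hL' : ∀ i ∉ L, q ≤ d i) (hb : ∀ i, b i < d i)
    (hsum : ∑ i, (d i - 1) ≤ ∑ i ∈ L, (d i - 1) + ∑ i, b i)
    (hprod : ∏ i, (b i + 1) ≤ ∏ i ∈ Lᶜ, d i) (i : ι) :
    (b i = 0 ∧ d i ≤ q) ∨ (b i + 1 = d i ∧ q ≤ d i) := by
  have hcases := eq_zero_or_eq_of_prod_add_one_le (Nat.sub_pos_of_lt hq)
    (fun i hi => Nat.sub_le_sub_right (hL' i (Finset.mem_compl.mp hi)) 1)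
    (fun i hi => Nat.sub_le_sub_right (hL i (Finset.notMem_compl.mp hi)) 1)
    (fun i => Nat.le_sub_one_of_lt (hb i)) (sum_compl_le_of_sum_le hsum)
    (hprod.trans_eq (prod_sub_one_add_one hb _).symm) i
  have hbi := hb i
  omega

end Boxes

/-! ### Standard monomials of a point of a commutative algebra -/

section Standard

variable {σ K R : Type*}

/-- The value at `x` of the monomial with exponent vector `b`. -/
def monomialValue [CommMonoid R] (x : σ → R) (b : σ →₀ ℕ) : R :=
  b.prod fun i e => x i ^ e

section CommMonoid

variable [CommMonoid R] (x : σ → R)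

lemma monomialValue_add (b c : σ →₀ ℕ) :
    monomialValue x (b + c) = monomialValue x b * monomialValue x c := by
  classical
  exact Finsupp.prod_add_index' (fun _ => pow_zero _) fun _ _ _ => pow_add _ _ _

@[simp]
lemma monomialValue_zero : monomialValue x 0 = 1 := Finsupp.prod_zero_index

@[simp]
lemma monomialValue_single (i : σ) (n : ℕ) : monomialValue x (Finsupp.single i n) = x i ^ n :=
  Finsupp.prod_single_index (pow_zero _)

end CommMonoid

section CommSemiring

variable [CommSemiring K] [CommSemiring R] [Algebra K R]

variable (K) in
/-- A monomial is standard at `x` if its value is not a linear combination of the values of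
smaller monomials. Over a field this means that it is not the leading monomial of a polynomial
vanishing at `x`. -/
def IsStandard (ord : MonomialOrder σ) (x : σ → R) (b : σ →₀ ℕ) : Prop :=
  monomialValue x b ∉
    Submodule.span K (monomialValue x '' {c | ord.toSyn c < ord.toSyn b})

variable {ord : MonomialOrder σ} {x : σ → R}

lemma IsStandard.of_le {b c : σ →₀ ℕ} (hb : IsStandard K ord x b) (hcb : c ≤ b) :
    IsStandard K ord x c := by
  intro hc
  obtain ⟨e, rfl⟩ := exists_add_of_le hcb
  have hmul := Submodule.mem_map_of_mem (f := LinearMap.mulLeft K (monomialValue x e)) hc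
  rw [Submodule.map_span, LinearMap.mulLeft_apply, mul_comm, ← monomialValue_add] at hmul
  refine hb (Submodule.span_mono ?_ hmul)
  rintro _ ⟨_, ⟨a, ha, rfl⟩, rfl⟩
  refine ⟨a + e, ?_, by rw [monomialValue_add, mul_comm, LinearMap.mulLeft_apply]⟩
  simpa using ha

lemma IsStandard.lt_of_pow_eq_pow {b : σ →₀ ℕ} (hb : IsStandard K ord x b) {i : σ} {d e : ℕ}
    (hed : e < d) (hx : x i ^ d = x i ^ e) : b i < d := by
  by_contra! hdb
  refine hb.of_le (Finsupp.single_le_iff.mpr hdb)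
    (Submodule.subset_span ⟨Finsupp.single i e, ord.toSyn_strictMono ?_, by simp [hx]⟩)
  exact lt_of_le_of_ne (Finsupp.single_mono hed.le) fun h =>
    hed.ne (Finsupp.single_injective i h)

lemma monomialValue_mem_span_standard (b : σ →₀ ℕ) :
    monomialValue x b ∈ Submodule.span K
      (monomialValue x '' {c | IsStandard K ord x c ∧ ord.toSyn c ≤ ord.toSyn b}) := by
  induction hn : ord.toSyn b using WellFoundedLT.induction generalizing b with
  | ind n ih =>
    subst hn
    by_cases hb : IsStandard K ord x b
    · exact Submodule.subset_span ⟨b, ⟨hb, le_rfl⟩, rfl⟩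
    · refine Submodule.span_le.mpr ?_ (not_not.mp hb)
      refine Set.image_subset_iff.mpr fun c (hc : ord.toSyn c < ord.toSyn b) => ?_
      exact Submodule.span_mono (Set.image_mono fun e he => And.imp_right (·.trans hc.le) he)
        (ih _ hc c rfl)

lemma linearMap_eq_zero_of_isStandard {M : Type*} [AddCommMonoid M] [Module K M]
    (hx : Submodule.span K (Set.range (monomialValue x)) = ⊤) {ℓ : R →ₗ[K] M}
    (hℓ : ∀ b, IsStandard K ord x b → ℓ (monomialValue x b) = 0) : ℓ = 0 := by
  refine LinearMap.ext_on_range hx fun b => ?_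
  refine Submodule.span_le (p := LinearMap.ker ℓ) |>.mpr ?_
    (monomialValue_mem_span_standard (K := K) (ord := ord) b)
  exact Set.image_subset_iff.mpr fun c hc => hℓ c hc.1

lemma mem_span_insert_one_of_isStandard_le [LinearOrder σ] [WellFoundedGT σ] {a : σ →₀ ℕ}
    (ha : ∀ b, IsStandard K MonomialOrder.degLex x b → b ≤ a) (i : σ) :
    x i ∈ Submodule.span K (insert 1 (x '' (a.support : Set σ))) := by
  have hi := monomialValue_mem_span_standard (K := K) (ord := MonomialOrder.degLex) (x := x)
    (Finsupp.single i 1)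
  rw [monomialValue_single, pow_one] at hi
  refine Submodule.span_mono ?_ hi
  rintro _ ⟨c, ⟨hc, hci⟩, rfl⟩
  have hdeg : c.degree ≤ 1 := by
    simpa using Finsupp.DegLex.monotone_degree (MonomialOrder.degLex_le_iff.mp hci)
  rcases Nat.le_one_iff_eq_zero_or_eq_one.mp hdeg with hdeg | hdeg
  · simp [(Finsupp.degree_eq_zero_iff c).mp hdeg]
  · obtain ⟨l, rfl⟩ := (Finsupp.range_single_one (σ := σ)).ge hdeg
    have hl : 1 ≤ a l := by simpa using ha _ hc l
    exact Or.inr ⟨l, by simpa using Nat.one_le_iff_ne_zero.mp hl, by simp⟩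

end CommSemiring

section Field

variable [Field K] [CommRing R] [Algebra K R] {ord : MonomialOrder σ} {x : σ → R}

lemma linearIndepOn_of_isStandard {s : Finset (σ →₀ ℕ)} (hs : ∀ b ∈ s, IsStandard K ord x b) :
    LinearIndepOn K (monomialValue x) (s : Set (σ →₀ ℕ)) := by
  classical
  induction s using Finset.induction_on_max_value ord.toSyn with
  | empty => simp
  | insert a s has hmax ih =>
    rw [Finset.coe_insert]
    refine (ih fun b hb => hs b (Finset.mem_insert_of_mem hb)).insert fun hmem => ?_
    refine hs a (Finset.mem_insert_self a s) (Submodule.span_mono (Set.image_mono ?_) hmem)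
    intro c hc
    exact (hmax c hc).lt_of_ne fun h => has (ord.toSyn.injective h ▸ hc)

variable [Module.Finite K R]

lemma card_le_finrank_of_isStandard {s : Finset (σ →₀ ℕ)}
    (hs : ∀ b ∈ s, IsStandard K ord x b) : s.card ≤ Module.finrank K R := by
  simpa using (linearIndepOn_of_isStandard hs).fintype_card_le_finrank

variable [Fintype σ] {a : σ →₀ ℕ}

lemma card_Iic_eq_prod_add_one [DecidableEq σ] (a : σ →₀ ℕ) :
    (Finset.Iic a).card = ∏ i, (a i + 1) := by
  rw [Finsupp.card_Iic]
  exact (Finset.prod_congr rfl fun i _ => Nat.card_Iic (a i)).trans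
    (Finset.prod_subset (Finset.subset_univ _) fun i _ hi => by
      simp [Finsupp.notMem_support_iff.mp hi])

lemma IsStandard.prod_add_one_le_finrank (ha : IsStandard K ord x a) :
    ∏ i, (a i + 1) ≤ Module.finrank K R := by
  classical
  rw [← card_Iic_eq_prod_add_one]
  exact card_le_finrank_of_isStandard fun b hb => ha.of_le (Finset.mem_Iic.mp hb)

lemma IsStandard.isGreatest_of_finrank_le (ha : IsStandard K ord x a)
    (hfin : Module.finrank K R ≤ ∏ i, (a i + 1)) : IsGreatest {b | IsStandard K ord x b} a := by
  classical
  refine ⟨ha, fun b hb => ?_⟩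
  by_contra hba
  have hcard : (insert b (Finset.Iic a)).card ≤ Module.finrank K R :=
    card_le_finrank_of_isStandard (Finset.forall_mem_insert _ _ _ |>.mpr
      ⟨hb, fun c hc => ha.of_le (Finset.mem_Iic.mp hc)⟩)
  rw [Finset.card_insert_of_notMem (by simpa using hba), card_Iic_eq_prod_add_one] at hcard
  omega

end Field

end Standard

/-! ### Closure properties of affine Cartesian codes -/

section Subfields

variable {F : Type*} [Field F] [Finite F]

lemma pow_natCard_eq_self {K : Subfield F} {x : F} (hx : x ∈ K) : x ^ Nat.card K = x := by
  have := Fintype.ofFinite K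
  rw [Nat.card_eq_fintype_card]
  exact congrArg Subtype.val (FiniteField.pow_card (⟨x, hx⟩ : K))

lemma one_sub_pow_natCard_sub_one {K : Subfield F} {x : F} (hx : x ∈ K) (hx0 : x ≠ 0) :
    1 - x ^ (Nat.card K - 1) = 0 := by
  have hpow : x ^ (Nat.card K - 1) * x = 1 * x := by
    rw [pow_sub_one_mul Nat.card_pos.ne', pow_natCard_eq_self hx, one_mul]
  rw [mul_right_cancel₀ hx0 hpow, sub_self]

lemma coe_eq_setOf_pow_natCard_eq_self (K : Subfield F) :
    (K : Set F) = {x | x ^ Nat.card K = x} := by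
  classical
  have hq : 1 < Nat.card K := Finite.one_lt_card
  refine Set.eq_of_subset_of_ncard_le (fun x hx => pow_natCard_eq_self hx) ?_
  have hroots : {x : F | x ^ Nat.card K = x} =
      ((Polynomial.X ^ Nat.card K - Polynomial.X : Polynomial F).roots.toFinset : Set F) := by
    ext x
    simp [FiniteField.X_pow_card_sub_X_ne_zero F hq, sub_eq_zero]
  rw [hroots, Set.ncard_coe_finset]
  calc
    _ ≤ _ := Multiset.toFinset_card_le _
    _ ≤ _ := Polynomial.card_roots' _
    _ = Nat.card K := FiniteField.X_pow_card_sub_X_natDegree_eq F hq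

lemma subfield_eq_of_natCard_eq {K L : Subfield F} (h : Nat.card K = Nat.card L) : K = L :=
  SetLike.coe_injective <| by
    rw [coe_eq_setOf_pow_natCard_eq_self, coe_eq_setOf_pow_natCard_eq_self, h]

end Subfields

lemma exists_lt_forall_pow_eq_pow {M : Type*} [Monoid M] {d : ℕ} (hd : 1 < d) (a : ℕ) :
    ∃ b ≤ a, b < d ∧ ∀ x : M, x ^ d = x → x ^ b = x ^ a := by
  induction a using Nat.strong_induction_on with
  | _ a ih =>
    rcases lt_or_ge a d with h | h
    · exact ⟨a, le_rfl, h, fun _ _ => rfl⟩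
    · obtain ⟨b, hb, hbd, hx⟩ := ih (a - d + 1) (by omega)
      refine ⟨b, by omega, hbd, fun x hxd => ?_⟩
      calc
        x ^ b = x ^ (a - d) * x ^ d := by rw [hx x hxd, pow_succ, hxd]
        _ = x ^ a := by rw [← pow_add, Nat.sub_add_cancel h]

section Codes

variable {F : Type*} [Field F] {m : ℕ} {A : Fin m → Subfield F}

lemma evalWord_apply (p : MvPolynomial (Fin m) F) (P : (i : Fin m) → A i) :
    evalWord A p P = MvPolynomial.eval (fun i => (P i : F)) p := rfl

lemma evalWord_mul (p q : MvPolynomial (Fin m) F) :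
    evalWord A (p * q) = evalWord A p * evalWord A q := by
  ext P
  simp [evalWord_apply]

variable [Finite F] {u v : ℕ} {f g : ((i : Fin m) → A i) → F}

/-- Exponents are reduced modulo the polynomials `X_i ^ d_i - X_i`, which vanish on `A_i`. -/
lemma evalWord_monomial_mem_affineCartesianCode {a : Fin m →₀ ℕ} (ha : a.degree ≤ u) (c : F) :
    evalWord A (MvPolynomial.monomial a c) ∈ affineCartesianCode A u := by
  choose b hba hbd hb using fun i => exists_lt_forall_pow_eq_pow (M := F)
    (Finite.one_lt_card (α := A i)) (a i)
  refine ⟨MvPolynomial.monomial (Finsupp.equivFunOnFinite.symm b) c, ⟨?_, fun i => ?_⟩, ?_⟩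
  · refine (MvPolynomial.totalDegree_monomial_le _ _).trans (le_trans ?_ ha)
    rw [Finsupp.sum_fintype _ _ fun _ => rfl, Finsupp.degree_eq_sum]
    exact Finset.sum_le_sum fun i _ => hba i
  · refine lt_of_le_of_lt ((MvPolynomial.degreeOf_le_iff).mpr fun e he => ?_) (hbd i)
    rw [Finset.mem_singleton.mp (MvPolynomial.support_monomial_subset he)]
    rfl
  · ext P
    rw [evalWord_apply, evalWord_apply, MvPolynomial.eval_monomial, MvPolynomial.eval_monomial,
      Finsupp.prod_fintype _ _ fun _ => pow_zero _, Finsupp.prod_fintype _ _ fun _ => pow_zero _]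
    exact congrArg (c * ·)
      (Finset.prod_congr rfl fun i _ => hb i _ (pow_natCard_eq_self (P i).2))

lemma mem_affineCartesianCode :
    f ∈ affineCartesianCode A u ↔
      ∃ p : MvPolynomial (Fin m) F, p.totalDegree ≤ u ∧ evalWord A p = f := by
  constructor
  · rintro ⟨p, hp, rfl⟩
    exact ⟨p, hp.1, rfl⟩
  · rintro ⟨p, hp, rfl⟩
    rw [p.as_sum, map_sum]
    exact Submodule.sum_mem _ fun a ha => evalWord_monomial_mem_affineCartesianCode
      ((MvPolynomial.le_totalDegree ha).trans hp) _

lemma mul_mem_affineCartesianCode (hf : f ∈ affineCartesianCode A u)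
    (hg : g ∈ affineCartesianCode A v) : f * g ∈ affineCartesianCode A (u + v) := by
  obtain ⟨p, hp, rfl⟩ := mem_affineCartesianCode.mp hf
  obtain ⟨q, hq, rfl⟩ := mem_affineCartesianCode.mp hg
  exact mem_affineCartesianCode.mpr
    ⟨p * q, (MvPolynomial.totalDegree_mul p q).trans (add_le_add hp hq), evalWord_mul p q⟩

lemma const_mem_affineCartesianCode (c : F) : (fun _ => c) ∈ affineCartesianCode A u :=
  mem_affineCartesianCode.mpr ⟨MvPolynomial.C c, by simp, by ext; simp [evalWord_apply]⟩

lemma one_mem_affineCartesianCode : 1 ∈ affineCartesianCode A u :=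
  const_mem_affineCartesianCode 1

lemma coord_mem_affineCartesianCode (i : Fin m) : (fun P => (P i : F)) ∈ affineCartesianCode A 1 :=
  mem_affineCartesianCode.mpr ⟨MvPolynomial.X i, by simp, by ext; simp [evalWord_apply]⟩

lemma prod_mem_affineCartesianCode {ι : Type*} {s : Finset ι} {n : ι → ℕ}
    {f : ι → ((i : Fin m) → A i) → F} (hf : ∀ i ∈ s, f i ∈ affineCartesianCode A (n i)) :
    ∏ i ∈ s, f i ∈ affineCartesianCode A (∑ i ∈ s, n i) := by
  classical
  induction s using Finset.induction_on with
  | empty => exact one_mem_affineCartesianCode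
  | insert a s ha ih =>
    rw [Finset.prod_insert ha, Finset.sum_insert ha]
    exact mul_mem_affineCartesianCode (hf a (Finset.mem_insert_self a s))
      (ih fun i hi => hf i (Finset.mem_insert_of_mem hi))

lemma pow_mem_affineCartesianCode (hf : f ∈ affineCartesianCode A u) (k : ℕ) :
    f ^ k ∈ affineCartesianCode A (k * u) := by
  simpa using prod_mem_affineCartesianCode (s := Finset.range k) fun _ _ => hf

lemma indicator_zeros_mem_affineCartesianCode {K : Subfield F} (hg : g ∈ affineCartesianCode A 1)
    (hgK : ∀ P, g P ∈ K) :
    {P | g P = 0}.indicator 1 ∈ affineCartesianCode A (Nat.card K - 1) := by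
  have hpow : 1 - g ^ (Nat.card K - 1) ∈ affineCartesianCode A (Nat.card K - 1) :=
    Submodule.sub_mem _ one_mem_affineCartesianCode
      (by simpa using pow_mem_affineCartesianCode hg (Nat.card K - 1))
  convert hpow
  ext P
  by_cases hP : g P = 0
  · have hK : Nat.card K - 1 ≠ 0 := (Nat.sub_pos_of_lt Finite.one_lt_card).ne'
    simp [hP, hK]
  · simp [hP, one_sub_pow_natCard_sub_one (hgK P) hP]

end Codes

/-! ### Duality and the minimum distance -/

section Duality

open scoped Matrix

variable {F : Type*} [Field F] {m : ℕ} {A : Fin m → Subfield F}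

/-- The coordinate functions on a set of points, whose standard monomials form the footprint of the
vanishing ideal of the set. -/
def coordOn (S : Set ((i : Fin m) → A i)) (i : Fin m) : S → F := fun P => P.1 i

lemma monomialValue_coordOn (S : Set ((i : Fin m) → A i)) (b : Fin m →₀ ℕ) (P : S) :
    monomialValue (coordOn S) b P = evalWord A (MvPolynomial.monomial b 1) P := by
  rw [evalWord_apply, MvPolynomial.eval_monomial, one_mul, monomialValue,
    Finsupp.prod_fintype _ _ fun _ => pow_zero _, Finsupp.prod_fintype _ _ fun _ => pow_zero _,
    Finset.prod_apply]
  rfl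

lemma sum_prod_pow_eq_zero [∀ i, Fintype (A i)] {b : Fin m → ℕ}
    (hb : ∑ i, b i < ∑ i, (Nat.card (A i) - 1)) :
    ∑ P : (i : Fin m) → A i, ∏ i, (P i : F) ^ b i = 0 := by
  classical
  obtain ⟨i, -, hi⟩ := Finset.exists_lt_of_sum_lt hb
  have hfactor : ∑ x : A i, x ^ b i = 0 :=
    FiniteField.sum_pow_lt_card_sub_one (A i) (b i) (by rwa [← Nat.card_eq_fintype_card])
  rw [← Fintype.piFinset_univ, ← Finset.prod_univ_sum (fun i => (Finset.univ : Finset (A i)))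
    fun i x => (x : F) ^ b i]
  exact Finset.prod_eq_zero (Finset.mem_univ i) (by simpa using congrArg Subtype.val hfactor)

lemma finrank_fun_eq_ncard (F : Type*) [Field F] {ι : Type*} (S : Set ι) [Finite S] :
    Module.finrank F (S → F) = S.ncard := by
  have := Fintype.ofFinite S
  rw [Module.finrank_fintype_fun_eq_card, ← Nat.card_eq_fintype_card, Nat.card_coe_set_eq]

variable [Finite F]

lemma span_monomialValue_coordOn (S : Set ((i : Fin m) → A i)) :
    Submodule.span F (Set.range (monomialValue (coordOn S))) = ⊤ := by
  have := Fintype.ofFinite F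
  have hinj : Function.Injective fun (P : S) (i : Fin m) => (P.1 i : F) := fun P Q h =>
    Subtype.ext (funext fun i => Subtype.ext (congrFun h i))
  refine Submodule.eq_top_iff'.mpr fun g => ?_
  obtain ⟨p, -, hp⟩ := (MvPolynomial.map_restrict_dom_evalₗ F (Fin m)).ge
    (Submodule.mem_top (x := Function.extend (fun (P : S) (i : Fin m) => (P.1 i : F)) g 0))
  have hg : g = ∑ a ∈ p.support, p.coeff a • monomialValue (coordOn S) a := by
    ext P
    rw [← hinj.extend_apply g 0 P, ← hp, MvPolynomial.evalₗ_apply, MvPolynomial.eval_eq',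
      Finset.sum_apply]
    refine Finset.sum_congr rfl fun a _ => ?_
    rw [Pi.smul_apply, monomialValue_coordOn, evalWord_apply, MvPolynomial.eval_monomial, one_mul,
      smul_eq_mul, Finsupp.prod_fintype _ _ fun _ => pow_zero _]
  rw [hg]
  exact Submodule.sum_mem _ fun a _ => Submodule.smul_mem _ _ (Submodule.subset_span ⟨a, rfl⟩)

lemma IsStandard.lt_natCard {S : Set ((i : Fin m) → A i)} {ord : MonomialOrder (Fin m)}
    {b : Fin m →₀ ℕ} (hb : IsStandard F ord (coordOn S) b) (i : Fin m) : b i < Nat.card (A i) :=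
  hb.lt_of_pow_eq_pow Finite.one_lt_card (e := 1)
    (funext fun P => (pow_natCard_eq_self (P.1 i).2).trans (pow_one _).symm)

variable {u : ℕ} {f : ((i : Fin m) → A i) → F}

lemma sum_eq_zero_of_mem_affineCartesianCode [∀ i, Fintype (A i)]
    (hf : f ∈ affineCartesianCode A u)
    (hu : u < ∑ i, (Nat.card (A i) - 1)) : ∑ P, f P = 0 := by
  obtain ⟨p, hp, rfl⟩ := mem_affineCartesianCode.mp hf
  simp only [evalWord_apply, MvPolynomial.eval_eq']
  rw [Finset.sum_comm]
  refine Finset.sum_eq_zero fun a ha => ?_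
  rw [← Finset.mul_sum, sum_prod_pow_eq_zero, mul_zero]
  rw [← Finsupp.degree_eq_sum]
  exact ((MvPolynomial.le_totalDegree ha).trans hp).trans_lt hu

variable {S : Set ((i : Fin m) → A i)}

lemma dotProduct_monomialValue_eq_zero [Fintype S] {b : Fin m →₀ ℕ}
    (hf : f ∈ affineCartesianCode A u)
    (hfS : Function.support f ⊆ S) (hb : u + b.degree < ∑ i, (Nat.card (A i) - 1)) :
    S.domRestrict f ⬝ᵥ monomialValue (coordOn S) b = 0 := by
  have := fun i => Fintype.ofFinite (A i)
  refine (Fintype.sum_of_injective Subtype.val Subtype.val_injective _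
    (f * evalWord A (MvPolynomial.monomial b 1)) (fun P hP => ?_) fun P => ?_).trans
    (sum_eq_zero_of_mem_affineCartesianCode
      (mul_mem_affineCartesianCode hf (evalWord_monomial_mem_affineCartesianCode le_rfl 1)) hb)
  · have hfP : f P = 0 := Function.notMem_support.mp fun h => hP ⟨⟨P, hfS h⟩, rfl⟩
    rw [Pi.mul_apply, hfP, zero_mul]
  · rw [monomialValue_coordOn]
    rfl

lemma exists_isStandard_dotProduct_ne_zero [Fintype S] (ord : MonomialOrder (Fin m))
    (hf : f ∈ affineCartesianCode A u) (hfS : Function.support f ⊆ S) (hf0 : f ≠ 0) :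
    ∃ b, IsStandard F ord (coordOn S) b ∧ ∑ i, (Nat.card (A i) - 1) ≤ u + b.degree ∧
      S.domRestrict f ⬝ᵥ monomialValue (coordOn S) b ≠ 0 := by
  classical
  by_contra! horth
  have hzero : dotProductBilin F F (S.domRestrict f) = 0 :=
    linearMap_eq_zero_of_isStandard (ord := ord) (span_monomialValue_coordOn S) fun b hb => by
      by_cases hdeg : ∑ i, (Nat.card (A i) - 1) ≤ u + b.degree
      · exact horth b hb hdeg
      · exact dotProduct_monomialValue_eq_zero hf hfS (not_le.mp hdeg)
  have hfS0 : S.domRestrict f = 0 := dotProduct_eq_zero _ fun g => LinearMap.congr_fun hzero g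
  refine hf0 (funext fun P => ?_)
  by_contra hP
  exact hP (congrFun hfS0 ⟨P, hfS hP⟩)

variable {q : ℕ} {L : Finset (Fin m)}

lemma prod_compl_natCard_le_ncard (hq : 1 < q) (hL : ∀ i ∈ L, Nat.card (A i) ≤ q)
    (hL' : ∀ i ∉ L, q ≤ Nat.card (A i))
    (hf : f ∈ affineCartesianCode A (∑ i ∈ L, (Nat.card (A i) - 1)))
    (hfS : Function.support f ⊆ S) (hf0 : f ≠ 0) : ∏ i ∈ Lᶜ, Nat.card (A i) ≤ S.ncard := by
  have := Fintype.ofFinite S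
  obtain ⟨b, hb, hdeg, -⟩ :=
    exists_isStandard_dotProduct_ne_zero MonomialOrder.degLex hf hfS hf0
  calc
    _ ≤ ∏ i, (b i + 1) := prod_compl_le_prod_add_one hq hL hL' hb.lt_natCard
      (hdeg.trans_eq (congrArg _ (Finsupp.degree_eq_sum b)))
    _ ≤ S.ncard := hb.prod_add_one_le_finrank.trans_eq (finrank_fun_eq_ncard F S)

lemma exists_isGreatest_isStandard [Fintype S] (hq : 1 < q) (hL : ∀ i ∈ L, Nat.card (A i) ≤ q)
    (hL' : ∀ i ∉ L, q ≤ Nat.card (A i)) (hS : S.ncard = ∏ i ∈ Lᶜ, Nat.card (A i))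
    (hf : f ∈ affineCartesianCode A (∑ i ∈ L, (Nat.card (A i) - 1)))
    (hfS : Function.support f ⊆ S) (hf0 : f ≠ 0) (ord : MonomialOrder (Fin m)) :
    ∃ a, IsGreatest {b | IsStandard F ord (coordOn S) b} a ∧ ∏ i, (a i + 1) = S.ncard ∧
      (∀ i, (a i = 0 ∧ Nat.card (A i) ≤ q) ∨ (a i + 1 = Nat.card (A i) ∧ q ≤ Nat.card (A i))) ∧
      S.domRestrict f ⬝ᵥ monomialValue (coordOn S) a ≠ 0 := by
  obtain ⟨a, ha, hdeg, hfa⟩ := exists_isStandard_dotProduct_ne_zero ord hf hfS hf0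
  rw [Finsupp.degree_eq_sum] at hdeg
  have hprod : ∏ i, (a i + 1) = S.ncard :=
    (ha.prod_add_one_le_finrank.trans_eq (finrank_fun_eq_ncard F S)).antisymm
      (hS.trans_le (prod_compl_le_prod_add_one hq hL hL' ha.lt_natCard hdeg))
  exact ⟨a, ha.isGreatest_of_finrank_le ((finrank_fun_eq_ncard F S).trans hprod.symm).le, hprod,
    eq_zero_or_add_one_eq_of_prod_le hq hL hL' ha.lt_natCard hdeg (hprod.trans hS).le, hfa⟩

/-- The pairing with the greatest standard monomial is injective on the codewords supported in
`S`. -/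
lemma exists_eq_smul_of_support_subset (hq : 1 < q) (hL : ∀ i ∈ L, Nat.card (A i) ≤ q)
    (hL' : ∀ i ∉ L, q ≤ Nat.card (A i)) (hS : S.ncard = ∏ i ∈ Lᶜ, Nat.card (A i))
    {g : ((i : Fin m) → A i) → F}
    (hf : f ∈ affineCartesianCode A (∑ i ∈ L, (Nat.card (A i) - 1)))
    (hfS : Function.support f ⊆ S)
    (hg : g ∈ affineCartesianCode A (∑ i ∈ L, (Nat.card (A i) - 1)))
    (hgS : Function.support g ⊆ S) (hg0 : g ≠ 0) : ∃ c : F, f = c • g := by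
  have := Fintype.ofFinite S
  obtain ⟨a, ha, -, -, hga⟩ :=
    exists_isGreatest_isStandard hq hL hL' hS hg hgS hg0 MonomialOrder.degLex
  let pairing (h : ((i : Fin m) → A i) → F) : F :=
    S.domRestrict h ⬝ᵥ monomialValue (coordOn S) a
  let c := pairing f / pairing g
  have hpairing : pairing (f - c • g) = 0 := by
    have hlin : pairing (f - c • g) = pairing f - c * pairing g := by
      rw [← smul_eq_mul, ← smul_dotProduct, ← sub_dotProduct]
      rfl
    rw [hlin, div_mul_cancel₀ _ hga, sub_self]
  refine ⟨c, sub_eq_zero.mp ?_⟩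
  by_contra hne
  have hsupp : Function.support (f - c • g) ⊆ S :=
    (Function.support_sub f _).trans
      (Set.union_subset hfS ((Function.support_const_smul_subset c g).trans hgS))
  obtain ⟨b, hb, -, -, hhb⟩ := exists_isGreatest_isStandard hq hL hL' hS
    (Submodule.sub_mem _ hf (Submodule.smul_mem _ c hg)) hsupp hne MonomialOrder.degLex
  exact hhb (hb.unique ha ▸ hpairing)

end Duality

/-! ### Affine graphs and flats -/

section Flats

variable {F : Type*} [Field F] {m : ℕ} {A : Fin m → Subfield F}

/-- The set `S` is the graph of an affine map from the coordinates in `T` to all coordinates, with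
constant terms `γ i` and coefficients `α i l`, normalized to vanish for `l ∉ T`. -/
structure IsAffineGraph (S : Set ((i : Fin m) → A i)) (T : Finset (Fin m)) (γ : Fin m → F)
    (α : Fin m → Fin m → F) : Prop where
  coeff_eq_zero : ∀ i, ∀ l ∉ T, α i l = 0
  eq_affine : ∀ P ∈ S, ∀ i, (P i : F) = γ i + ∑ l, α i l * P l
  exists_eq_on : ∀ y : (i : Fin m) → A i, ∃ Q ∈ S, ∀ l ∈ T, Q l = y l

section IsAffineGraph

variable {S : Set ((i : Fin m) → A i)} {T : Finset (Fin m)} {γ : Fin m → F}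
  {α : Fin m → Fin m → F}

lemma sum_coeff_mul_congr (hα : ∀ i, ∀ l ∉ T, α i l = 0) {P Q : (i : Fin m) → A i}
    (hPQ : ∀ l ∈ T, P l = Q l) (i : Fin m) : ∑ l, α i l * (P l : F) = ∑ l, α i l * (Q l : F) := by
  refine Finset.sum_congr rfl fun l _ => ?_
  by_cases hl : l ∈ T
  · rw [hPQ l hl]
  · rw [hα i l hl, zero_mul, zero_mul]

lemma isAffineGraph_of_ncard_eq [Finite F] (hα : ∀ i, ∀ l ∉ T, α i l = 0)
    (haff : ∀ P ∈ S, ∀ i, (P i : F) = γ i + ∑ l, α i l * P l)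
    (hcard : S.ncard = ∏ i ∈ T, Nat.card (A i)) : IsAffineGraph S T γ α := by
  refine ⟨hα, haff, fun y => ?_⟩
  let restrictT (P : S) (l : T) : A l := P.1 l
  have hinj : Function.Injective restrictT := fun P Q hPQ => by
    ext i
    rw [haff P P.2, haff Q Q.2,
      sum_coeff_mul_congr hα fun l hl => congrFun hPQ (⟨l, hl⟩ : T)]
  have hbij : Function.Bijective restrictT :=
    (Nat.bijective_iff_injective_and_card _).mpr ⟨hinj, by
      rw [Nat.card_coe_set_eq, hcard, Nat.card_pi, Finset.prod_coe_sort T fun i => Nat.card (A i)]⟩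
  obtain ⟨Q, hQ⟩ := hbij.2 fun l => y l
  exact ⟨Q, Q.2, fun l hl => congrFun hQ ⟨l, hl⟩⟩

namespace IsAffineGraph

lemma sub_eq_sum (h : IsAffineGraph S T γ α) {P P₀ : (i : Fin m) → A i} (hP : P ∈ S)
    (hP₀ : P₀ ∈ S) (i : Fin m) : (P i - P₀ i : F) = ∑ l, α i l * (P l - P₀ l) := by
  simp only [mul_sub, Finset.sum_sub_distrib]
  linear_combination h.eq_affine P hP i - h.eq_affine P₀ hP₀ i

lemma mem_of_sub_eq_sum (h : IsAffineGraph S T γ α) {P P₀ : (i : Fin m) → A i} (hP₀ : P₀ ∈ S)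
    (hP : ∀ i ∉ T, (P i - P₀ i : F) = ∑ l, α i l * (P l - P₀ l)) : P ∈ S := by
  obtain ⟨Q, hQ, hQP⟩ := h.exists_eq_on P
  suffices Q = P from this ▸ hQ
  ext i
  by_cases hi : i ∈ T
  · rw [hQP i hi]
  · have hPi := hP i hi
    simp only [mul_sub, Finset.sum_sub_distrib] at hPi
    linear_combination h.eq_affine Q hQ i - h.eq_affine P₀ hP₀ i - hPi +
      sum_coeff_mul_congr h.coeff_eq_zero hQP i

/-- When only the `l`-th coordinate varies, the `i`-th one is an injective function of it if the
coefficient does not vanish. -/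
lemma coeff_eq_zero_of_natCard_lt [Finite F] (h : IsAffineGraph S T γ α) {i l : Fin m}
    (hil : Nat.card (A i) < Nat.card (A l)) : α i l = 0 := by
  by_contra hα
  choose Q hQS hQ using fun x : A l => h.exists_eq_on (Pi.single l x)
  have hval (x : A l) : (Q x i : F) = γ i + α i l * x := by
    rw [h.eq_affine _ (hQS x), sum_coeff_mul_congr h.coeff_eq_zero (hQ x),
      Finset.sum_eq_single_of_mem l (Finset.mem_univ l) fun l' _ hl' => by
        simp [Pi.single_eq_of_ne hl'], Pi.single_eq_same]
  have hinj : Function.Injective fun x => Q x i := fun x y hxy => by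
    have hF : (Q x i : F) = Q y i := congrArg Subtype.val hxy
    rw [hval, hval] at hF
    exact Subtype.ext (mul_left_cancel₀ hα (add_left_cancel hF))
  exact (Nat.card_le_card_of_injective _ hinj).not_gt hil

variable [Finite F] {K : Subfield F} (h : IsAffineGraph S T γ α)
  (hT : ∀ i ∈ T, Nat.card K ≤ Nat.card (A i))

include h hT

lemma coeff_eq_zero_of_natCard_lt_natCard {i : Fin m} (hi : Nat.card (A i) < Nat.card K)
    (l : Fin m) : α i l = 0 := by
  by_cases hl : l ∈ T
  · exact h.coeff_eq_zero_of_natCard_lt (hi.trans_le (hT l hl))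
  · exact h.coeff_eq_zero i l hl

lemma coeff_eq_zero_of_ne {i l : Fin m} (hi : A i = K) (hl : A l ≠ K) : α i l = 0 := by
  by_cases hlT : l ∈ T
  · refine h.coeff_eq_zero_of_natCard_lt ?_
    rw [hi]
    exact (hT l hlT).lt_of_ne fun hcard => hl (subfield_eq_of_natCard_eq hcard.symm)
  · exact h.coeff_eq_zero i l hlT

open Classical in
lemma sum_coeff_mul_eq_sum_block {i : Fin m} (hi : A i = K) (x : Fin m → F) :
    ∑ l, α i l * x l = ∑ l : {l // A l = K}, α i l * x l := by
  refine (Fintype.sum_of_injective Subtype.val Subtype.val_injective _ _ (fun l hl => ?_)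
    fun _ => rfl).symm
  rw [h.coeff_eq_zero_of_ne hT hi fun hlK => hl ⟨⟨l, hlK⟩, rfl⟩, zero_mul]

end IsAffineGraph

end IsAffineGraph

/-- The coordinates of a point whose field is smaller than `K`, together with the coordinates whose
field is equal to `K`. -/
def lowBlockPart (A : Fin m → Subfield F) (K : Subfield F) :
    ((i : Fin m) → A i) →+
      ((i : {i // Nat.card (A i) < Nat.card K}) → A i) × ({i // A i = K} → K) where
  toFun P := (fun i => P i, fun i => ⟨P i, i.2.le (P i).2⟩)
  map_zero' := rfl
  map_add' _ _ := rfl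

lemma lowBlockPart_surjective (A : Fin m → Subfield F) (K : Subfield F) :
    Function.Surjective (lowBlockPart A K) := by
  classical
  rintro ⟨p, w⟩
  refine ⟨fun i => if hlow : Nat.card (A i) < Nat.card K then p ⟨i, hlow⟩ else
    if hblock : A i = K then ⟨w ⟨i, hblock⟩, hblock.ge (w _).2⟩ else 0, ?_⟩
  refine Prod.ext (funext fun i => dif_pos i.2) (funext fun i => Subtype.ext ?_)
  simp [lowBlockPart, i.2]

variable {K : Subfield F}

/-- The points whose coordinates over fields smaller than `K` are given by `p` and whose
coordinates over `K` lie in the coset `v` of `W`; the coordinates over the remaining fields are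
arbitrary. -/
def flat (p : (i : {i // Nat.card (A i) < Nat.card K}) → A i)
    (W : Submodule K ({i // A i = K} → K)) (v : ({i // A i = K} → K) ⧸ W) :
    Set ((i : Fin m) → A i) :=
  {P | (lowBlockPart A K P).1 = p ∧ W.mkQ (lowBlockPart A K P).2 = v}

open Classical in
/-- The vectors over `K` that satisfy the homogeneous part of the affine relations with coefficients
`α`. -/
def relationSpace (A : Fin m → Subfield F) (K : Subfield F) (α : Fin m → Fin m → F) :
    Submodule K ({i // A i = K} → K) where
  carrier := {w | ∀ i : {i // A i = K}, (w i : F) = ∑ l : {l // A l = K}, α i l * w l}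
  zero_mem' i := by simp
  add_mem' {w w'} hw hw' i := by
    simp [hw i, hw' i, mul_add, Finset.sum_add_distrib]
  smul_mem' c w hw i := by
    simp [hw i, Finset.mul_sum, mul_left_comm]

theorem IsAffineGraph.exists_eq_flat [Finite F] {S : Set ((i : Fin m) → A i)}
    {T : Finset (Fin m)} {γ : Fin m → F} {α : Fin m → Fin m → F} (h : IsAffineGraph S T γ α)
    (hT : ∀ i ∈ T, Nat.card K ≤ Nat.card (A i)) (hT' : ∀ i ∉ T, Nat.card (A i) ≤ Nat.card K) :
    ∃ p W v, S = flat (K := K) p W v := by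
  obtain ⟨P₀, hP₀, -⟩ := h.exists_eq_on 0
  refine ⟨(lowBlockPart A K P₀).1, relationSpace A K α, Submodule.mkQ _ (lowBlockPart A K P₀).2, ?_⟩
  ext P
  have hmkQ : Submodule.mkQ (relationSpace A K α) (lowBlockPart A K P).2 =
      Submodule.mkQ _ (lowBlockPart A K P₀).2 ↔
      ∀ i, A i = K → (P i - P₀ i : F) = ∑ l, α i l * (P l - P₀ l) := by
    refine (Submodule.Quotient.eq _).trans (Subtype.forall.trans (forall₂_congr fun i hi => ?_))
    rw [h.sum_coeff_mul_eq_sum_block hT hi fun l => (P l - P₀ l : F)]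
    rfl
  constructor
  · refine fun hP => ⟨funext fun i => Subtype.ext (sub_eq_zero.mp ?_),
      hmkQ.mpr fun i _ => h.sub_eq_sum hP hP₀ i⟩
    refine (h.sub_eq_sum hP hP₀ i).trans (Finset.sum_eq_zero fun l _ => ?_)
    rw [h.coeff_eq_zero_of_natCard_lt_natCard hT i.2, zero_mul]
  · rintro ⟨hlow, hblock⟩
    refine h.mem_of_sub_eq_sum hP₀ fun i hi => ?_
    rcases (hT' i hi).lt_or_eq with hlt | heq
    · rw [show P i = P₀ i from congrFun hlow ⟨i, hlt⟩, sub_self]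
      exact (Finset.sum_eq_zero fun l _ => by
        rw [h.coeff_eq_zero_of_natCard_lt_natCard hT hlt, zero_mul]).symm
    · exact hmkQ.mp hblock i (subfield_eq_of_natCard_eq heq)

lemma exists_affine_of_mem_span_insert_one {S : Set ((i : Fin m) → A i)} {T : Finset (Fin m)}
    {g : S → F} (hg : g ∈ Submodule.span F (insert 1 (coordOn S '' T))) :
    ∃ (γ : F) (α : Fin m → F), (∀ l ∉ T, α l = 0) ∧ ∀ P : S, g P = γ + ∑ l, α l * P.1 l := by
  obtain ⟨γ, z, hz, rfl⟩ := Submodule.mem_span_insert.mp hg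
  obtain ⟨α, hα, rfl⟩ := (Finsupp.mem_span_image_iff_linearCombination F).mp hz
  refine ⟨γ, α, fun l hl => Finsupp.notMem_support_iff.mp fun h => hl (hα h), fun P => ?_⟩
  rw [Finsupp.linearCombination_apply, Finsupp.sum_fintype _ _ (by simp)]
  simp [coordOn]

theorem exists_eq_flat_of_ncard_eq [Finite F] {S : Set ((i : Fin m) → A i)} {L : Finset (Fin m)}
    (hL : ∀ i ∈ L, Nat.card (A i) ≤ Nat.card K) (hL' : ∀ i ∉ L, Nat.card K ≤ Nat.card (A i))
    (hS : S.ncard = ∏ i ∈ Lᶜ, Nat.card (A i)) {f : ((i : Fin m) → A i) → F}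
    (hf : f ∈ affineCartesianCode A (∑ i ∈ L, (Nat.card (A i) - 1)))
    (hfS : Function.support f ⊆ S) (hf0 : f ≠ 0) : ∃ p W v, S = flat (K := K) p W v := by
  have := Fintype.ofFinite S
  obtain ⟨a, ha, hprod, hbox, -⟩ := exists_isGreatest_isStandard Finite.one_lt_card hL hL' hS hf
    hfS hf0 MonomialOrder.degLex
  choose γ α hα haff using fun i => exists_affine_of_mem_span_insert_one
    (mem_span_insert_one_of_isStandard_le (fun _ hb => ha.2 hb) i)
  have hT (i : Fin m) (hi : i ∈ a.support) :
      a i + 1 = Nat.card (A i) ∧ Nat.card K ≤ Nat.card (A i) :=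
    (hbox i).resolve_left fun h => Finsupp.mem_support_iff.mp hi h.1
  have hT' (i : Fin m) (hi : i ∉ a.support) : Nat.card (A i) ≤ Nat.card K :=
    (hbox i).elim And.right fun h => by
      rw [Finsupp.notMem_support_iff.mp hi] at h
      exact absurd h.1 Finite.one_lt_card.ne
  have hcard : S.ncard = ∏ i ∈ a.support, Nat.card (A i) := by
    rw [← hprod, ← Finset.prod_subset a.support.subset_univ fun i _ hi => by
      rw [Finsupp.notMem_support_iff.mp hi, zero_add]]
    exact Finset.prod_congr rfl fun i hi => (hT i hi).1
  exact (isAffineGraph_of_ncard_eq hα (fun P hP i => haff i ⟨P, hP⟩) hcard).exists_eq_flat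
    (fun i hi => (hT i hi).2) hT'

end Flats

/-! ### Words supported on flats -/

section FlatWords

lemma ncard_preimage_singleton_mul_natCard {G H : Type*} [AddGroup G] [AddGroup H] {φ : G →+ H}
    (hφ : Function.Surjective φ) (h : H) : (φ ⁻¹' {h}).ncard * Nat.card H = Nat.card G := by
  rw [← Nat.card_coe_set_eq, Nat.card_congr (AddMonoidHom.fiberEquivKerOfSurjective hφ h),
    ← φ.ker.card_mul_index, AddSubgroup.index_ker, AddMonoidHom.range_eq_top.mpr hφ,
    AddSubgroup.card_top]

variable {F : Type*} [Field F] {m : ℕ} {A : Fin m → Subfield F} {K : Subfield F}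
  (p : (i : {i // Nat.card (A i) < Nat.card K}) → A i) (W : Submodule K ({i // A i = K} → K))
  (v : ({i // A i = K} → K) ⧸ W)

lemma flat_nonempty : (flat p W v).Nonempty := by
  obtain ⟨w, rfl⟩ := W.mkQ_surjective v
  obtain ⟨P, hP⟩ := lowBlockPart_surjective A K (p, w)
  exact ⟨P, by rw [hP], by rw [hP]⟩

lemma ncard_flat_mul :
    (flat p W v).ncard * ((∏ i : {i // Nat.card (A i) < Nat.card K}, Nat.card (A i)) *
      Nat.card K ^ Module.finrank K (({i // A i = K} → K) ⧸ W)) = ∏ i, Nat.card (A i) := by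
  let φ := ((AddMonoidHom.id ((i : {i // Nat.card (A i) < Nat.card K}) → A i)).prodMap
    W.mkQ.toAddMonoidHom).comp (lowBlockPart A K)
  have hφ : Function.Surjective φ :=
    (Function.surjective_id.prodMap W.mkQ_surjective).comp (lowBlockPart_surjective A K)
  have hflat : flat p W v = φ ⁻¹' {(p, v)} :=
    Set.ext fun P => (Prod.ext_iff (x := φ P) (y := (p, v))).symm
  rw [← Nat.card_pi, ← Nat.card_pi, ← ncard_preimage_singleton_mul_natCard hφ (p, v), ← hflat,
    Nat.card_prod, ← Module.natCard_eq_pow_finrank]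

variable {p W v}

lemma mem_iff_exists_mem_flat {P : (i : Fin m) → A i} (hP : P ∈ flat p W v)
    (w : {i // A i = K} → K) :
    w ∈ W ↔ ∃ Q ∈ flat p W v, (lowBlockPart A K Q).2 = (lowBlockPart A K P).2 + w := by
  have hadd : W.mkQ ((lowBlockPart A K P).2 + w) = v ↔ w ∈ W := by
    rw [map_add, hP.2, add_eq_left, Submodule.mkQ_apply, Submodule.Quotient.mk_eq_zero]
  refine ⟨fun hw => ?_, ?_⟩
  · obtain ⟨Q, hQ⟩ := lowBlockPart_surjective A K (p, (lowBlockPart A K P).2 + w)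
    exact ⟨Q, ⟨by rw [hQ], by rw [hQ, hadd.mpr hw]⟩, by rw [hQ]⟩
  · rintro ⟨Q, hQ, hQw⟩
    exact hadd.mp (hQw ▸ hQ.2)

lemma flat_injective {p' : (i : {i // Nat.card (A i) < Nat.card K}) → A i}
    {W' : Submodule K ({i // A i = K} → K)} {v' : ({i // A i = K} → K) ⧸ W'}
    (h : flat p W v = flat p' W' v') : p = p' ∧ W = W' ∧ v ≍ v' := by
  obtain ⟨P, hP⟩ := flat_nonempty p W v
  have hP' : P ∈ flat p' W' v' := h ▸ hP
  obtain rfl : W = W' := Submodule.ext fun w => by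
    rw [mem_iff_exists_mem_flat hP, mem_iff_exists_mem_flat hP', h]
  exact ⟨hP.1.symm.trans hP'.1, rfl, heq_of_eq (hP.2.symm.trans hP'.2)⟩

variable [Finite F]

lemma indicator_iInter_mem_affineCartesianCode {ι : Type*} [Fintype ι] {n : ι → ℕ}
    {Z : ι → Set ((i : Fin m) → A i)} (hZ : ∀ i, (Z i).indicator 1 ∈ affineCartesianCode A (n i)) :
    (⋂ i, Z i).indicator 1 ∈ affineCartesianCode A (∑ i, n i) := by
  have hprod := prod_mem_affineCartesianCode (s := Finset.univ) fun i _ => hZ i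
  rw [prod_indicator_const, one_pow] at hprod
  simpa using hprod

lemma linearMap_block_mem_affineCartesianCode (φ : ({i // A i = K} → K) →ₗ[K] K) :
    (fun P => (φ (lowBlockPart A K P).2 : F)) ∈ affineCartesianCode A 1 := by
  classical
  have hφ : (fun P => (φ (lowBlockPart A K P).2 : F)) =
      ∑ l : {l // A l = K}, (φ (fun j => if l = j then 1 else 0) : F) •
        fun P : (i : Fin m) → A i => (P l : F) := by
    ext P
    rw [LinearMap.pi_apply_eq_sum_univ φ]
    simp [lowBlockPart, mul_comm]
  rw [hφ]
  exact Submodule.sum_mem _ fun l _ => Submodule.smul_mem _ _ (coord_mem_affineCartesianCode _)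

variable (p W v)

lemma indicator_flat_mem_affineCartesianCode :
    (flat p W v).indicator 1 ∈ affineCartesianCode A
      (∑ i : {i // Nat.card (A i) < Nat.card K}, (Nat.card (A i) - 1) +
        Module.finrank K (({i // A i = K} → K) ⧸ W) * (Nat.card K - 1)) := by
  let φ := (Module.finBasis K (({i // A i = K} → K) ⧸ W)).equivFun
  have hflat : flat p W v =
      (⋂ i : {i // Nat.card (A i) < Nat.card K}, {P | (P i : F) - p i = 0}) ∩
      ⋂ t, {P | (φ (W.mkQ (lowBlockPart A K P).2) t : F) - φ v t = 0} := by
    ext P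
    simp only [flat, Set.mem_ofPred_eq, Set.mem_inter_iff, Set.mem_iInter, sub_eq_zero,
      SetLike.coe_eq_coe, funext_iff, ← φ.injective.eq_iff (b := v)]
    rfl
  rw [hflat, Set.inter_indicator_one]
  refine mul_mem_affineCartesianCode
    (indicator_iInter_mem_affineCartesianCode fun i => ?_) ?_
  · exact indicator_zeros_mem_affineCartesianCode (Submodule.sub_mem _
      (coord_mem_affineCartesianCode _) (const_mem_affineCartesianCode _))
      fun P => sub_mem (P i).2 (p i).2
  · have hcut := indicator_iInter_mem_affineCartesianCode fun t =>
      indicator_zeros_mem_affineCartesianCode (K := K) (Submodule.sub_mem _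
        (linearMap_block_mem_affineCartesianCode (LinearMap.proj t ∘ₗ φ.toLinearMap ∘ₗ W.mkQ))
        (const_mem_affineCartesianCode (φ v t : F))) fun P => sub_mem (Subtype.prop _) (φ v t).2
    simpa using hcut

end FlatWords

/-! ### Counting the minimum weight codewords -/

section Counting

open scoped Finset

lemma wordWeight_eq_ncard_support {ι F : Type*} [Finite ι] [Zero F] (c : ι → F) :
    wordWeight c = (Function.support c).ncard := by
  unfold wordWeight hammingNorm
  rw [← Set.ncard_coe_finset]
  congr 1
  ext i
  simp

lemma minWeightWords_eq_setOf_ncard_support_eq {ι F : Type*} [Finite ι] [Field F]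
    {C : Submodule F (ι → F)} {N : ℕ} (hN : ∀ c ∈ C, c ≠ 0 → N ≤ (Function.support c).ncard)
    (hex : ∃ c ∈ C, c ≠ 0 ∧ (Function.support c).ncard = N) :
    minWeightWords C = {c | c ∈ C ∧ c ≠ 0 ∧ (Function.support c).ncard = N} := by
  simp only [minWeightWords, wordWeight_eq_ncard_support]
  ext c
  refine and_congr_right fun hc => and_congr_right fun hc0 => ⟨fun hmin => ?_, ?_⟩
  · obtain ⟨c₀, hc₀, hc₀0, rfl⟩ := hex
    exact (hmin c₀ hc₀ hc₀0).antisymm (hN c hc hc0)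
  · rintro rfl
    exact hN

section Grassmannian

variable (K V : Type*) [Field K] [AddCommGroup V] [Module K V] [FiniteDimensional K V]

theorem card_finrank_quotient_eq_gaussianBinomial (k : ℕ) :
    Nat.card {W : Submodule K V // Module.finrank K (V ⧸ W) = k} =
      gaussianBinomial K (Module.finrank K V) k := by
  let e : Module.Dual K V ≃ₗ[K] (Fin (Module.finrank K V) → K) :=
    (Module.finBasis K V).dualBasis.equivFun
  let Φ := Subspace.orderIsoFiniteDimensional (K := K) (V := V) |>.toEquiv.trans
    (OrderDual.ofDual.trans (Submodule.orderIsoMapComap e).toEquiv)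
  refine Nat.card_congr (Φ.subtypeEquiv fun W => ?_)
  rw [← (LinearEquiv.finrank_map_eq e W.dualAnnihilator).trans
    ((Submodule.dualQuotEquivDualAnnihilator W).finrank_eq.symm.trans Subspace.dual_finrank_eq)]
  rfl

lemma exists_finrank_quotient_eq {k : ℕ} (hk : k ≤ Module.finrank K V) :
    ∃ W : Submodule K V, Module.finrank K (V ⧸ W) = k := by
  let φ := LinearMap.funLeft K K (Fin.castLE hk) ∘ₗ (Module.finBasis K V).equivFun.toLinearMap
  have hφ : Function.Surjective φ :=
    (LinearMap.funLeft_surjective_of_injective K K _ (Fin.castLE_injective hk)).comp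
      (Module.finBasis K V).equivFun.surjective
  exact ⟨LinearMap.ker φ, by
    rw [(φ.quotKerEquivOfSurjective hφ).finrank_eq, Module.finrank_fin_fun]⟩

end Grassmannian

variable {F : Type*} [Field F] {m : ℕ} {A : Fin m → Subfield F} {K : Subfield F}

open Classical in
lemma finrank_block_fun (A : Fin m → Subfield F) (K : Subfield F) :
    Module.finrank K ({i // A i = K} → K) = #{i | A i = K} := by
  rw [Module.finrank_fintype_fun_eq_card, Fintype.card_subtype]

/-- The parameters `p`, `W` and `v` of a flat, for subspaces `W` of codimension `k`. -/
abbrev FlatParam (A : Fin m → Subfield F) (K : Subfield F) (k : ℕ) : Type _ :=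
  ((i : {i // Nat.card (A i) < Nat.card K}) → A i) ×
    (Σ W : {W : Submodule K ({i // A i = K} → K) //
      Module.finrank K (({i // A i = K} → K) ⧸ W) = k}, ({i // A i = K} → K) ⧸ W.1)

/-- The word that takes the value `x.1` on the flat with parameters `x.2` and vanishes elsewhere. -/
noncomputable def flatWord {k : ℕ} (x : Fˣ × FlatParam A K k) : ((i : Fin m) → A i) → F :=
  (x.1 : F) • (flat x.2.1 x.2.2.1.1 x.2.2.2).indicator 1

section flatWord

variable {k : ℕ}

lemma support_flatWord (x : Fˣ × FlatParam A K k) :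
    Function.support (flatWord x) = flat x.2.1 x.2.2.1.1 x.2.2.2 := by
  rw [flatWord, Function.support_const_smul_of_ne_zero _ _ x.1.ne_zero, Set.support_indicator,
    Function.support_one, Set.inter_univ]

lemma flatWord_ne_zero (x : Fˣ × FlatParam A K k) : flatWord x ≠ 0 := by
  rw [← Function.support_nonempty_iff, support_flatWord]
  exact flat_nonempty _ _ _

lemma flatWord_injective : Function.Injective (flatWord : Fˣ × FlatParam A K k → _) := by
  rintro ⟨c, p, ⟨W, hW⟩, v⟩ ⟨c', p', ⟨W', hW'⟩, v'⟩ h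
  have hflat := congrArg Function.support h
  rw [support_flatWord, support_flatWord] at hflat
  obtain ⟨rfl, rfl, hv⟩ := flat_injective hflat
  obtain rfl := eq_of_heq hv
  obtain ⟨P, hP⟩ := flat_nonempty p W v
  have hc := congrFun h P
  simp only [flatWord, Pi.smul_apply, Set.indicator_of_mem hP, Pi.one_apply, smul_eq_mul,
    mul_one] at hc
  rw [Units.ext hc]

variable [Finite F]

lemma flatWord_mem_affineCartesianCode (x : Fˣ × FlatParam A K k) :
    flatWord x ∈ affineCartesianCode A
      (∑ i : {i // Nat.card (A i) < Nat.card K}, (Nat.card (A i) - 1) +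
        k * (Nat.card K - 1)) := by
  have hmem := indicator_flat_mem_affineCartesianCode x.2.1 x.2.2.1.1 x.2.2.2
  rw [x.2.2.1.2] at hmem
  exact Submodule.smul_mem _ _ hmem

variable (A K k)

open Classical in
lemma natCard_units_prod_flatParam : Nat.card (Fˣ × FlatParam A K k) =
    (Nat.card F - 1) *
      ((∏ i : {i // Nat.card (A i) < Nat.card K}, Nat.card (A i)) * Nat.card K ^ k) *
      gaussianBinomial K #{i | A i = K} k := by
  have := Fintype.ofFinite {W : Submodule K ({i // A i = K} → K) //
    Module.finrank K (({i // A i = K} → K) ⧸ W) = k}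
  have (W : Submodule K ({i // A i = K} → K)) : Finite (({i // A i = K} → K) ⧸ W) :=
    Finite.of_surjective _ W.mkQ_surjective
  have hcoset (W : {W : Submodule K ({i // A i = K} → K) //
      Module.finrank K (({i // A i = K} → K) ⧸ W) = k}) :
      Nat.card (({i // A i = K} → K) ⧸ W.1) = Nat.card K ^ k := by
    rw [Module.natCard_eq_pow_finrank (K := K), W.2]
  simp only [Nat.card_prod, Nat.card_units, Nat.card_pi, Nat.card_sigma, hcoset, Finset.sum_const,
    Finset.card_univ, ← Nat.card_eq_fintype_card, card_finrank_quotient_eq_gaussianBinomial,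
    finrank_block_fun, smul_eq_mul]
  ring

end flatWord

open Classical in
@[to_additive]
lemma prod_natCard_eq_prod_low_mul_pow [Finite F] {M : Type*} [CommMonoid M] {L : Finset (Fin m)}
    (hL : ∀ i ∈ L, Nat.card (A i) ≤ Nat.card K) (hL' : ∀ i ∉ L, Nat.card K ≤ Nat.card (A i))
    (g : ℕ → M) :
    ∏ i ∈ L, g (Nat.card (A i)) =
      (∏ i : {i // Nat.card (A i) < Nat.card K}, g (Nat.card (A i))) *
        g (Nat.card K) ^ #{i ∈ L | A i = K} := by
  have hlow (i : Fin m) : i ∈ L.filter (¬ A · = K) ↔ Nat.card (A i) < Nat.card K := by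
    rw [Finset.mem_filter]
    exact ⟨fun h => (hL i h.1).lt_of_ne fun hcard => h.2 (subfield_eq_of_natCard_eq hcard),
      fun h => ⟨by_contra fun hi => (hL' i hi).not_gt h, fun hK => h.ne (by rw [hK])⟩⟩
  have hblock : ∏ i ∈ L with A i = K, g (Nat.card (A i)) = g (Nat.card K) ^ #{i ∈ L | A i = K} :=
    Finset.prod_eq_pow_card fun i hi => by rw [(Finset.mem_filter.mp hi).2]
  rw [← Finset.prod_filter_mul_prod_filter_not L (A · = K), mul_comm, hblock,
    Finset.prod_subtype _ hlow fun i => g (Nat.card (A i))]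

variable [Finite F] {L : Finset (Fin m)} (hL : ∀ i ∈ L, Nat.card (A i) ≤ Nat.card K)
  (hL' : ∀ i ∉ L, Nat.card K ≤ Nat.card (A i))

include hL hL'

open Classical in
lemma flatWord_mem (x : Fˣ × FlatParam A K #{i ∈ L | A i = K}) :
    flatWord x ∈ affineCartesianCode A (∑ i ∈ L, (Nat.card (A i) - 1)) := by
  rw [sum_natCard_eq_sum_low_add_nsmul hL hL' (· - 1), smul_eq_mul]
  exact flatWord_mem_affineCartesianCode x

open Classical in
lemma ncard_flat_eq_prod_compl_iff (p : (i : {i // Nat.card (A i) < Nat.card K}) → A i)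
    (W : Submodule K ({i // A i = K} → K)) (v : ({i // A i = K} → K) ⧸ W) :
    (flat p W v).ncard = ∏ i ∈ Lᶜ, Nat.card (A i) ↔
      Module.finrank K (({i // A i = K} → K) ⧸ W) = #{i ∈ L | A i = K} := by
  have hsplit : ∏ i ∈ L, Nat.card (A i) = _ := prod_natCard_eq_prod_low_mul_pow hL hL' id
  have hflat := ncard_flat_mul p W v
  rw [← Finset.prod_compl_mul_prod L, hsplit] at hflat
  have hlow : 0 < ∏ i : {i // Nat.card (A i) < Nat.card K}, Nat.card (A i) :=
    Finset.prod_pos fun i _ => Nat.card_pos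
  constructor
  · intro hcard
    rw [hcard] at hflat
    exact Nat.pow_right_injective Finite.one_lt_card (Nat.eq_of_mul_eq_mul_left hlow
      (Nat.eq_of_mul_eq_mul_left (Finset.prod_pos fun i _ => Nat.card_pos) hflat))
  · intro hrank
    rw [hrank] at hflat
    exact Nat.eq_of_mul_eq_mul_right (Nat.mul_pos hlow (Nat.pow_pos Nat.card_pos)) hflat

open Classical in
theorem minWeightWords_eq_range_flatWord :
    minWeightWords (affineCartesianCode A (∑ i ∈ L, (Nat.card (A i) - 1))) =
      Set.range (flatWord : Fˣ × FlatParam A K #{i ∈ L | A i = K} → _) := by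
  have hq : 1 < Nat.card K := Finite.one_lt_card
  have hword (x : Fˣ × FlatParam A K #{i ∈ L | A i = K}) :
      (Function.support (flatWord x)).ncard = ∏ i ∈ Lᶜ, Nat.card (A i) := by
    rw [support_flatWord, ncard_flat_eq_prod_compl_iff hL hL', x.2.2.1.2]
  obtain ⟨W₀, hW₀⟩ := exists_finrank_quotient_eq K ({i // A i = K} → K)
    (k := #{i ∈ L | A i = K}) (by
      rw [finrank_block_fun]
      exact Finset.card_le_card (Finset.filter_subset_filter _ L.subset_univ))
  let x₀ : Fˣ × FlatParam A K #{i ∈ L | A i = K} := ⟨1, 0, ⟨W₀, hW₀⟩, 0⟩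
  rw [minWeightWords_eq_setOf_ncard_support_eq
    (fun c hc hc0 => prod_compl_natCard_le_ncard hq hL hL' hc subset_rfl hc0)
    ⟨flatWord x₀, flatWord_mem hL hL' x₀, flatWord_ne_zero x₀, hword x₀⟩]
  ext f
  constructor
  · rintro ⟨hf, hf0, hcard⟩
    obtain ⟨p, W, v, hflat⟩ := exists_eq_flat_of_ncard_eq hL hL' hcard hf subset_rfl hf0
    have hW := (ncard_flat_eq_prod_compl_iff hL hL' p W v).mp (hflat ▸ hcard)
    let x : Fˣ × FlatParam A K #{i ∈ L | A i = K} := ⟨1, p, ⟨W, hW⟩, v⟩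
    obtain ⟨c, rfl⟩ := exists_eq_smul_of_support_subset hq hL hL' hcard hf subset_rfl
      (flatWord_mem hL hL' x) ((support_flatWord x).trans hflat.symm).le (flatWord_ne_zero x)
    have hc : c ≠ 0 := fun hc => hf0 (by rw [hc, zero_smul])
    exact ⟨⟨Units.mk0 c hc, x.2⟩, by simp [flatWord, x]⟩
  · rintro ⟨x, rfl⟩
    exact ⟨flatWord_mem hL hL' x, flatWord_ne_zero x, hword x⟩

end Counting

/-! ### Blocks of coordinates -/

section Blocks

open scoped Finset

variable {lam : ℕ} {μ : Fin lam → ℕ}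

lemma partialSum_succ (t : Fin lam) : partialSum μ (t + 1) = partialSum μ t + μ t := by
  classical
  have hinsert : ({i | i.val < t.val + 1} : Finset (Fin lam)) =
      insert t ({i | i.val < t.val} : Finset (Fin lam)) := by
    ext i
    simp only [Finset.mem_filter_univ, Finset.mem_insert, Fin.ext_iff]
    lia
  rw [partialSum, hinsert, Finset.sum_insert (by simp), add_comm, partialSum]

lemma partialSum_mono : Monotone (partialSum μ) := fun _ _ hab =>
  Finset.sum_le_sum_of_subset <| Finset.monotone_filter_right _ fun _ _ hi => hi.trans_le hab

lemma partialSum_eq_sum : partialSum μ lam = ∑ t, μ t := by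
  simp [partialSum]

variable {m : ℕ}

lemma exists_inBlock (i : Fin m) (hi : i < ∑ t, μ t) : ∃ t, InBlock μ t i := by
  have hex : ∃ T, i < partialSum μ T := ⟨lam, partialSum_eq_sum.symm ▸ hi⟩
  have hle : Nat.find hex ≤ lam := Nat.find_min' hex (partialSum_eq_sum.symm ▸ hi)
  obtain ⟨T, hT⟩ : ∃ T, Nat.find hex = T + 1 :=
    Nat.exists_eq_add_one.mpr ((Nat.find_pos hex).mpr (by simp [partialSum]))
  exact ⟨⟨T, by lia⟩, not_lt.mp (Nat.find_min hex (by lia)), hT ▸ Nat.find_spec hex⟩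

lemma InBlock.le_of_le {i j : Fin m} {t r : Fin lam} (hi : InBlock μ t i) (hj : InBlock μ r j)
    (hij : i ≤ j) : t ≤ r := by
  by_contra! hrt
  have hsum : partialSum μ (r + 1) ≤ partialSum μ t := partialSum_mono (Nat.succ_le_of_lt hrt)
  exact absurd ((hj.2.trans_le hsum).trans_le hi.1) (not_lt.mpr hij)

open Classical in
lemma card_filter_inBlock (hm : ∑ t, μ t ≤ m) (r : Fin lam) :
    #{i : Fin m | InBlock μ r i} = μ r := by
  have hend : partialSum μ (r + 1) ≤ m :=
    (partialSum_mono r.2).trans (partialSum_eq_sum.le.trans hm)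
  have hmap : ({i | InBlock μ r i} : Finset (Fin m)).map Fin.valEmbedding =
      Finset.Ico (partialSum μ r) (partialSum μ (r + 1)) := by
    ext k
    simp only [Finset.mem_map, Finset.mem_filter_univ, Fin.valEmbedding_apply, Finset.mem_Ico]
    exact ⟨by rintro ⟨i, hi, rfl⟩; exact hi, fun hk => ⟨⟨k, hk.2.trans_le hend⟩, hk, rfl⟩⟩
  rw [← Finset.card_map, hmap, Nat.card_Ico, partialSum_succ, Nat.add_sub_cancel_left]

open Classical in
lemma InBlock.card_filter_Iic {j : Fin m} {r : Fin lam} (hj : InBlock μ r j) :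
    #{i ∈ Finset.Iic j | InBlock μ r i} = j + 1 - partialSum μ r := by
  have hIcc : ({i ∈ Finset.Iic j | InBlock μ r i} : Finset (Fin m)) =
      Finset.Icc ⟨partialSum μ r, hj.1.trans_lt j.2⟩ j := by
    ext i
    rw [Finset.mem_filter, Finset.mem_Iic, Finset.mem_Icc]
    exact ⟨fun h => ⟨h.2.1, h.1⟩, fun h => ⟨h.2, h.1, (Fin.le_def.mp h.2).trans_lt hj.2⟩⟩
  rw [hIcc, Fin.card_Icc]

end Blocks

open Classical in
theorem mainTheorem2_general {F : Type*} [Field F] [Finite F] {m : ℕ} (A : Fin m → Subfield F)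
    (K : Subfield F) (L : Finset (Fin m)) (hL : ∀ i ∈ L, Nat.card (A i) ≤ Nat.card K)
    (hL' : ∀ i ∉ L, Nat.card K ≤ Nat.card (A i)) :
    (minWeightWords (affineCartesianCode A (∑ i ∈ L, (Nat.card (A i) - 1)))).ncard =
      (Nat.card F - 1) * (∏ i ∈ L, Nat.card (A i)) *
        gaussianBinomial K (Finset.card {i | A i = K}) (Finset.card {i ∈ L | A i = K}) := by
  have hprod : ∏ i ∈ L, Nat.card (A i) = _ := prod_natCard_eq_prod_low_mul_pow hL hL' id
  rw [minWeightWords_eq_range_flatWord hL hL', ← Set.image_univ,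
    Set.ncard_image_of_injective _ flatWord_injective, Set.ncard_univ,
    natCard_units_prod_flatParam, hprod]
  rfl

theorem mainTheorem2 {F : Type*} [Field F] [Finite F] {m lam : ℕ}
    (Fs : Fin lam → Subfield F) (hFs : StrictMono Fs)
    (μ : Fin lam → ℕ) (hμ : ∀ t, 0 < μ t) (hm : ∑ t, μ t = m)
    (A : Fin m → Subfield F)
    (hA : ∀ (i : Fin m) (t : Fin lam), InBlock μ t i → A i = Fs t)
    (j : Fin m) (r : Fin lam) (hr : InBlock μ r j)
    (u : ℕ) (hu : u = ∑ i ∈ Finset.Iic j, (Nat.card (A i) - 1)) :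
    (minWeightWords (affineCartesianCode A u)).ncard =
      (Nat.card F - 1) * (∏ i ∈ Finset.Iic j, Nat.card (A i)) *
        gaussianBinomial (A j) (μ r) (j.val + 1 - partialSum μ r.val) := by
  classical
  have hblock (i : Fin m) : ∃ t, InBlock μ t i := exists_inBlock i (hm ▸ i.2)
  have hmono : Monotone A := fun i k hik => by
    obtain ⟨⟨t, ht⟩, s, hs⟩ := hblock i, hblock k
    rw [hA i t ht, hA k s hs]
    exact hFs.monotone (ht.le_of_le hs hik)
  have hcard {i k : Fin m} (hik : i ≤ k) : Nat.card (A i) ≤ Nat.card (A k) :=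
    Nat.card_mono (Set.toFinite _) (hmono hik)
  have heq (i : Fin m) : A i = A j ↔ InBlock μ r i := by
    refine ⟨fun hij => ?_, fun hi => (hA i r hi).trans (hA j r hr).symm⟩
    obtain ⟨t, ht⟩ := hblock i
    rw [hA i t ht, hA j r hr] at hij
    exact hFs.injective hij ▸ ht
  rw [hu, mainTheorem2_general A (A j) (Finset.Iic j) (fun i hi => hcard (Finset.mem_Iic.mp hi))
    fun i hi => hcard (not_le.mp (mt Finset.mem_Iic.mpr hi)).le]
  simp only [heq, card_filter_inBlock hm.le, hr.card_filter_Iic]
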